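/- Let $T$ be a finite oriented simplicial complex homeomorphic to a closed disk whose boundary contains exactly four vertices $\mathbf p,\mathbf q,\mathbf r,\mathbf s$ (the corners), in the cyclic order given by the orientation. Let $\mathcal C$ be a finite set of constraints. Each constraint $C\in\mathcal C$ is the set of vertices of a set $S_C$ of triangles of $T$ that is nonempty and connected in the dual graph of $T$, and the sets $S_C$ are pairwise disjoint. Put $\mathcal T=(T,\mathcal C)$. A triangle of $T$ is living if no constraint contains all three of its vertices; let $T_1,\dots,T_n$ be the living triangles. A drawing of $\mathcal T$ is a map $\rho$ from the vertices of $T$ to $\mathbb C^2$ such that $\rho(C)$ lies on a complex line for each $C\in\mathcal C$, and $\rho(\mathbf p)+\rho(\mathbf r)=\rho(\mathbf q)+\rho(\mathbf s)$. It is generic if moreover no three consecutive corners have collinear images, no living triangle has collinear vertices, $\rho$ is injective, and any two distinct constraints with a common vertex span different lines. Let $X(\mathcal T)$ be the closure of the set of generic drawings in the space of all maps from the vertices to $\mathbb C^2$. Suppose that $\mathcal T$ is drawable, i.e. $X(\mathcal T)\neq\emptyset$. The area variety $V(\mathcal T)\subset\mathbb P^{n-1}(\mathbb C)$ is the Zariski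 closure of the set of points $[\mathrm{Area}(\rho(T_1)):\cdots:\mathrm{Area}(\rho(T_n))]$, where $\rho\in X(\mathcal T)$ is such that these signed areas are not all zero. Call $\mathcal T$ hyper if it is drawable and $V(\mathcal T)$ is a hypersurface in $\mathbb P^{n-1}$, i.e. the zero set of a nonzero homogeneous polynomial of positive degree. If $\mathcal T$ is hyper, its area polynomial $p\in\mathbb Z[A_1,\dots,A_n]$ is the nonzero homogeneous polynomial of least degree that vanishes on $V(\mathcal T)$ (least among all nonzero homogeneous polynomials with complex coefficients that vanish on $V(\mathcal T)$), normalized to have integer coefficients with no common factor; it is well defined up to sign. **Corollary.** Let $\mathcal T$ be hyper, and suppose that its area polynomial $p$ has degree $d$. Then for every $i=1,\dots,n$ the coefficient of $A_i^d$ in $p$ is odd, hence nonzero. -/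

import Mathlib

open scoped LinearAlgebra.Projectivization

/-- A finite oriented simplicial complex homeomorphic to a disk, with exactly four boundary
vertices.  `V` is the set of vertices, `ι` the set of triangles.  The triangle `i` has the vertices
`vertex i 0, vertex i 1, vertex i 2`, and this cyclic order is its orientation. -/
structure DiskTriangulation (V ι : Type*) [Fintype V] [DecidableEq V] [Fintype ι] where
  vertex : ι → Fin 3 → V
  /-- the three vertices of a triangle are distinct -/
  vertex_injective : ∀ i, Function.Injective (vertex i)
  /-- a triangle is determined by its set of vertices -/
  triangle_ext : ∀ i j, Set.range (vertex i) = Set.range (vertex j) → i = j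
  /-- every vertex lies on a triangle -/
  vertex_covered : ∀ v, ∃ i k, vertex i k = v
  /-- The orientations of the triangles are coherent: no two triangles induce the same direction
  on a common edge. -/
  coherent : ∀ i j k l, vertex i k = vertex j l → vertex i (k + 1) = vertex j (l + 1) → i = j
  /-- the corners `p, q, r, s` -/
  corner : Fin 4 → V
  corner_injective : Function.Injective corner
  /-- The boundary edges (those that lie on one triangle only), directed by the orientation, are
  `pq, qr, rs, sp`. -/
  boundary : ∀ u v,
    ((∃ i k, vertex i k = u ∧ vertex i (k + 1) = v) ∧
      ¬ (∃ i k, vertex i k = v ∧ vertex i (k + 1) = u)) ↔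
    ∃ c, corner c = u ∧ corner (c + 1) = v
  /-- The geometric realization, in barycentric coordinates, is homeomorphic to the closed unit
  disk. -/
  disk : Nonempty
    ({w : V → ℝ | (∀ v, 0 ≤ w v) ∧ ∑ v, w v = 1 ∧ ∃ i, ∀ v, w v ≠ 0 → v ∈ Set.range (vertex i)}
      ≃ₜ Metric.closedBall (0 : EuclideanSpace ℝ (Fin 2)) 1)

namespace DiskTriangulation

variable {V ι : Type*} [Fintype V] [DecidableEq V] [Fintype ι]

/-- The vertex set of a triangle. -/
def verts (T : DiskTriangulation V ι) (i : ι) : Finset V := Finset.univ.image (T.vertex i)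

/-- The dual graph: two distinct triangles are adjacent if they share an edge. -/
def dualGraph (T : DiskTriangulation V ι) : SimpleGraph ι where
  Adj i j := i ≠ j ∧ (T.verts i ∩ T.verts j).card = 2
  symm := ⟨fun _ _ h => ⟨h.1.symm, by rw [Finset.inter_comm]; exact h.2⟩⟩
  loopless := ⟨fun _ h => h.1 rfl⟩

end DiskTriangulation

/-- A constrained triangulation: a triangulated disk together with a set of collinearity
constraints.  Each constraint is the vertex set of a contiguous set of triangles, and these sets of
triangles are pairwise disjoint. -/
structure ConstrainedTriangulation (V ι : Type*) [Fintype V] [DecidableEq V] [Fintype ι] extends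
    DiskTriangulation V ι where
  constraints : Finset (Finset V)
  contiguous : ∃ S : Finset V → Finset ι,
    (∀ C ∈ constraints,
      (toDiskTriangulation.dualGraph.induce (S C : Set ι)).Connected ∧
      (S C).biUnion toDiskTriangulation.verts = C) ∧
    ∀ C ∈ constraints, ∀ C' ∈ constraints, C ≠ C' → Disjoint (S C) (S C')

/-- The signed area of the triangle with vertices `a, b, c`, in this order. -/
noncomputable def triangleArea (a b c : ℂ × ℂ) : ℂ :=
  (1 / 2) * Matrix.det !![1, 1, 1; a.1, b.1, c.1; a.2, b.2, c.2]

/-- The set of points of projective space at which the polynomial `F` vanishes.  Used for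
homogeneous `F` only, so that the choice of homogeneous coordinates does not matter. -/
def projZeros {σ : Type*} (F : MvPolynomial σ ℂ) : Set (ℙ ℂ (σ → ℂ)) :=
  {y | MvPolynomial.eval y.rep F = 0}

/-- The Zariski closure of a set of points of projective space. -/
def projClosure {σ : Type*} (S : Set (ℙ ℂ (σ → ℂ))) : Set (ℙ ℂ (σ → ℂ)) :=
  {y | ∀ (F : MvPolynomial σ ℂ) (k : ℕ), F.IsHomogeneous k → S ⊆ projZeros F → y ∈ projZeros F}

/-- A hypersurface: the zero set of a nonzero homogeneous polynomial of positive degree. -/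
def IsProjHypersurface {σ : Type*} (S : Set (ℙ ℂ (σ → ℂ))) : Prop :=
  ∃ (F : MvPolynomial σ ℂ) (k : ℕ), 0 < k ∧ F ≠ 0 ∧ F.IsHomogeneous k ∧ S = projZeros F

namespace ConstrainedTriangulation

variable {V ι : Type*} [Fintype V] [DecidableEq V] [Fintype ι]

/-- A triangle is alive if no constraint contains all of its vertices. -/
def Alive (T : ConstrainedTriangulation V ι) (i : ι) : Prop :=
  ∀ C ∈ T.constraints, ¬ T.verts i ⊆ C

/-- The living triangles. -/
abbrev Living (T : ConstrainedTriangulation V ι) : Type _ := {i : ι // T.Alive i}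

/-- Drawings: the vertices of each constraint lie on a line, and the corners form a
parallelogram. -/
def IsDrawing (T : ConstrainedTriangulation V ι) (ρ : V → ℂ × ℂ) : Prop :=
  (∀ C ∈ T.constraints, Collinear ℂ (ρ '' (C : Set V))) ∧
  ρ (T.corner 0) + ρ (T.corner 2) = ρ (T.corner 1) + ρ (T.corner 3)

/-- Generic drawings.  In the last condition, `ρ` being injective, each constraint spans a unique
line, and two constraints span the same line iff their union is collinear. -/
def IsGenericDrawing (T : ConstrainedTriangulation V ι) (ρ : V → ℂ × ℂ) : Prop :=
  T.IsDrawing ρ ∧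
  (∀ c : Fin 4,
    ¬ Collinear ℂ {ρ (T.corner c), ρ (T.corner (c + 1)), ρ (T.corner (c + 2))}) ∧
  (∀ i : ι, T.Alive i →
    ¬ Collinear ℂ {ρ (T.vertex i 0), ρ (T.vertex i 1), ρ (T.vertex i 2)}) ∧
  Function.Injective ρ ∧
  (∀ C ∈ T.constraints, ∀ C' ∈ T.constraints, C ≠ C' → (C ∩ C').Nonempty →
    ¬ Collinear ℂ (ρ '' ((C ∪ C' : Finset V) : Set V)))

/-- A constrained triangulation is drawable if it has a generic drawing. -/
def Drawable (T : ConstrainedTriangulation V ι) : Prop := ∃ ρ, T.IsGenericDrawing ρ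

/-- The space `X(T)`, the closure of the set of generic drawings. -/
def drawingSpace (T : ConstrainedTriangulation V ι) : Set (V → ℂ × ℂ) :=
  closure {ρ | T.IsGenericDrawing ρ}

/-- The areas of the living triangles in a drawing. -/
noncomputable def areas (T : ConstrainedTriangulation V ι) (ρ : V → ℂ × ℂ) : T.Living → ℂ :=
  fun i => triangleArea (ρ (T.vertex i 0)) (ρ (T.vertex i 1)) (ρ (T.vertex i 2))

/-- The area variety, the closure of the image of the rational area map from `X(T)` to the
projective space with one coordinate for each living triangle. -/
def areaVariety (T : ConstrainedTriangulation V ι) : Set (ℙ ℂ (T.Living → ℂ)) :=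
  projClosure {y | ∃ ρ ∈ T.drawingSpace, ∃ h : T.areas ρ ≠ 0,
    y = Projectivization.mk ℂ (T.areas ρ) h}

/-- `T` is hyper if it is drawable and its area variety is a hypersurface. -/
def Hyper (T : ConstrainedTriangulation V ι) : Prop :=
  T.Drawable ∧ IsProjHypersurface T.areaVariety

/-- `p` is an area polynomial of `T`: a nonzero homogeneous polynomial that vanishes on the area
variety, of the least degree among all such polynomials with complex coefficients (which makes it
unique up to scaling if `T` is hyper), normalized to have integer coefficients with no common
factor. -/
def IsAreaPolynomial (T : ConstrainedTriangulation V ι) (p : MvPolynomial T.Living ℤ) : Prop :=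
  p ≠ 0 ∧ p.IsHomogeneous p.totalDegree ∧
  T.areaVariety ⊆ projZeros (MvPolynomial.map (Int.castRingHom ℂ) p) ∧
  (∀ (F : MvPolynomial T.Living ℂ) (k : ℕ), F ≠ 0 → F.IsHomogeneous k →
    T.areaVariety ⊆ projZeros F → p.totalDegree ≤ k) ∧
  ∀ c : ℤ, (∀ m, c ∣ p.coeff m) → IsUnit c

end ConstrainedTriangulation

/-! ### Boundary sums over a triangulation -/

namespace DiskTriangulation

variable {V ι : Type*} [Fintype V] [DecidableEq V] [Fintype ι]

/-! The core is Monsky's theorem in the form of an integrality relation. Let `a i` be the areas of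
the living triangles and `s` their sum, the area of the parallelogram. For a valuation `v`, Monsky's
coloring and Sperner's argument give a triangle with `v s ≤ v (2 * a i)`
(`exists_corner_crossDet_le`). This is impossible if `v 2 < 1` and `v (a i) ≤ v s` for all `i`. Such
a valuation exists unless some relation `s ^ m + 2 c(a) = 0` holds, with `c` integral and
homogeneous of degree `m`. Hence there is one, and working over the ring of functions on the set of
drawings makes it uniform in the drawing.

With `S = ∑ X i`, the polynomial `f = S * (S ^ m + 2 c)` therefore vanishes on the area variety. The
variety is a hypersurface, so the Nullstellensatz and minimality of degree give `p ∣ f` over `ℂ`. As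
`p` is primitive, this descends to `N f = p g` over `ℤ` with `N` odd. At the `i`-th basis vector,
the left side is `N * (1 + 2 c(e_i))`, which is odd, and `p` takes its coefficient at `A_i ^ d` as
value; so this coefficient divides an odd number. -/

theorem directedEdge_injective (T : DiskTriangulation V ι) :
    Function.Injective fun e : ι × Fin 3 => (T.vertex e.1 e.2, T.vertex e.1 (e.2 + 1)) := by
  rintro ⟨i, k⟩ ⟨j, l⟩ h
  simp only [Prod.mk.injEq] at h
  obtain rfl := T.coherent i j k l h.1 h.2
  rw [T.vertex_injective i h.1]

/-- Stokes' formula: the sum of an alternating function over the directed edges of all triangles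
is its sum over the boundary edges. -/
theorem sum_alternating_eq_sum_corner {G : Type*} [AddCommGroup G] (T : DiskTriangulation V ι)
    (φ : V → V → G) (hφ : ∀ u v, φ u v = -φ v u) :
    ∑ i, ∑ k, φ (T.vertex i k) (T.vertex i (k + 1)) =
      ∑ c, φ (T.corner c) (T.corner (c + 1)) := by
  classical
  set E : Finset (V × V) :=
    Finset.univ.image fun e : ι × Fin 3 => (T.vertex e.1 e.2, T.vertex e.1 (e.2 + 1)) with hE
  have mem_E (u v : V) : (u, v) ∈ E ↔ ∃ i k, T.vertex i k = u ∧ T.vertex i (k + 1) = v := by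
    simp [hE]
  have hl : ∑ i, ∑ k, φ (T.vertex i k) (T.vertex i (k + 1)) = ∑ e ∈ E, φ e.1 e.2 := by
    rw [hE, Finset.sum_image fun _ _ _ _ h => T.directedEdge_injective h,
      ← Finset.univ_product_univ, Finset.sum_product]
  -- Interior edges occur in both directions, and reversal pairs off their contributions.
  have hint : ∑ e ∈ E with (e.2, e.1) ∈ E, φ e.1 e.2 = 0 := by
    refine Finset.sum_involution (fun e _ => (e.2, e.1)) ?_ ?_ ?_ ?_
    · intro e _
      simp [hφ e.1 e.2]
    · rintro ⟨u, v⟩ he _ h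
      obtain ⟨i, k, h1, h2⟩ := (mem_E u v).1 (Finset.mem_filter.1 he).1
      simp only [Prod.mk.injEq] at h
      have := T.vertex_injective i (h1.trans (h.2.trans h2.symm))
      exact absurd this (by generalize k = k'; revert k'; decide)
    · rintro ⟨u, v⟩ he
      simp only [Finset.mem_filter] at he ⊢
      exact he.symm
    · rintro ⟨u, v⟩ _
      rfl
  have hbd : (E.filter fun e => ¬ (e.2, e.1) ∈ E) =
      Finset.univ.image fun c : Fin 4 => (T.corner c, T.corner (c + 1)) := by
    ext ⟨u, v⟩
    have := T.boundary u v
    rw [← mem_E, ← mem_E] at this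
    simpa using this
  rw [hl, ← Finset.sum_filter_add_sum_filter_not E (fun e => (e.2, e.1) ∈ E), hint, zero_add, hbd,
    Finset.sum_image]
  intro c _ c' _ h
  exact T.corner_injective (Prod.mk.inj h).1

end DiskTriangulation

/-! ### Monsky's coloring and the large triangle -/

/-- Twice the signed area of the triangle `a, b, c`. -/
def crossDet {K : Type*} [CommRing K] (a b c : K × K) : K :=
  (b.1 - a.1) * (c.2 - a.2) - (c.1 - a.1) * (b.2 - a.2)

section Coloring

variable {K Γ : Type*} [Field K] [LinearOrderedCommGroupWithZero Γ] (v : Valuation K Γ)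

open Classical in
/-- Monsky's coloring of the plane over a valued field. -/
noncomputable def monskyColor (a : K × K) : Fin 3 :=
  if v a.1 < 1 ∧ v a.2 < 1 then 0 else if v a.2 ≤ v a.1 then 1 else 2

theorem monskyColor_eq_zero {a : K × K} (h : monskyColor v a = 0) : v a.1 < 1 ∧ v a.2 < 1 := by
  unfold monskyColor at h
  split_ifs at h with h1 h2
  · exact h1
  · exact absurd h (by decide)
  · exact absurd h (by decide)

theorem monskyColor_eq_one {a : K × K} (h : monskyColor v a = 1) :
    1 ≤ v a.1 ∧ v a.2 ≤ v a.1 := by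
  unfold monskyColor at h
  split_ifs at h with h1 h2
  · exact absurd h (by decide)
  swap
  · exact absurd h (by decide)
  refine ⟨?_, h2⟩
  by_contra! h3
  exact h1 ⟨h3, h2.trans_lt h3⟩

theorem monskyColor_eq_two {a : K × K} (h : monskyColor v a = 2) :
    1 ≤ v a.2 ∧ v a.1 < v a.2 := by
  unfold monskyColor at h
  split_ifs at h with h1 h2
  · exact absurd h (by decide)
  · exact absurd h (by decide)
  push Not at h2
  refine ⟨?_, h2⟩
  by_contra! h3
  exact h1 ⟨h2.trans h3, h3⟩

/-- Subtracting `a` does not change the valuations of `b.1` and `c.2`, and the product of these two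
strictly dominates the other term of the determinant. -/
theorem one_le_crossDet_of_monskyColor {a b c : K × K} (ha : monskyColor v a = 0)
    (hb : monskyColor v b = 1) (hc : monskyColor v c = 2) : 1 ≤ v (crossDet a b c) := by
  obtain ⟨ha1, ha2⟩ := monskyColor_eq_zero v ha
  obtain ⟨hb1, hb2⟩ := monskyColor_eq_one v hb
  obtain ⟨hc1, hc2⟩ := monskyColor_eq_two v hc
  have h1 : v (b.1 - a.1) = v b.1 := v.map_sub_eq_of_lt_left (ha1.trans_le hb1)
  have h2 : v (c.2 - a.2) = v c.2 := v.map_sub_eq_of_lt_left (ha2.trans_le hc1)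
  have h3 : v (c.1 - a.1) < v c.2 := v.map_sub_lt hc2 (ha1.trans_le hc1)
  have h4 : v (b.2 - a.2) ≤ v b.1 := v.map_sub_le hb2 (ha2.le.trans hb1)
  have h5 : v ((c.1 - a.1) * (b.2 - a.2)) < v ((b.1 - a.1) * (c.2 - a.2)) := by
    rw [map_mul, map_mul, h1, h2, mul_comm (v b.1)]
    exact mul_lt_mul_of_lt_of_le_of_nonneg_of_pos h3 h4 zero_le (zero_lt_one.trans_le hb1)
  rw [crossDet, v.map_sub_eq_of_lt_left h5, map_mul, h1, h2]
  exact one_le_mul hb1 hc1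

theorem crossDet_rotate (a b c : K × K) : crossDet b c a = crossDet a b c := by
  unfold crossDet; ring

theorem crossDet_swap (a b c : K × K) : crossDet a c b = -crossDet a b c := by
  unfold crossDet; ring

theorem crossDet_div (a b c : K × K) (t : K) :
    crossDet (a.1 / t, a.2 / t) (b.1 / t, b.2 / t) (c.1 / t, c.2 / t) =
      crossDet a b c / (t * t) := by
  simp only [crossDet, ← sub_div, div_mul_div_comm]

/-- The coboundary of the indicator of `0 → 1` edges detects rainbow triangles. -/
theorem color_rainbow (a b c : Fin 3)
    (h : (if a = 0 ∧ b = 1 then 1 else if a = 1 ∧ b = 0 then -1 else 0 : ℤ) +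
      (if b = 0 ∧ c = 1 then 1 else if b = 1 ∧ c = 0 then -1 else 0 : ℤ) +
      (if c = 0 ∧ a = 1 then 1 else if c = 1 ∧ a = 0 then -1 else 0 : ℤ) ≠ 0) :
    (a = 0 ∧ b = 1 ∧ c = 2) ∨ (b = 0 ∧ c = 1 ∧ a = 2) ∨ (c = 0 ∧ a = 1 ∧ b = 2) ∨
      (a = 0 ∧ c = 1 ∧ b = 2) ∨ (b = 0 ∧ a = 1 ∧ c = 2) ∨ (c = 0 ∧ b = 1 ∧ a = 2) := by
  revert a b c
  decide

variable {V ι : Type*} [Fintype V] [DecidableEq V] [Fintype ι]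

/-- Sperner's argument: around the unit square the corners are colored `0, 1, 1, 2`, so the signed
count of `0 → 1` edges on the boundary is `1`. By Stokes some triangle has a nonzero count, hence
all three colors. -/
theorem DiskTriangulation.exists_one_le_crossDet (T : DiskTriangulation V ι) (P : V → K × K)
    (h0 : P (T.corner 0) = (0, 0)) (h1 : P (T.corner 1) = (1, 0)) (h2 : P (T.corner 2) = (1, 1))
    (h3 : P (T.corner 3) = (0, 1)) :
    ∃ i, 1 ≤ v (crossDet (P (T.vertex i 0)) (P (T.vertex i 1)) (P (T.vertex i 2))) := by
  set col : V → Fin 3 := fun w => monskyColor v (P w) with hcol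
  have c0 : col (T.corner 0) = 0 := by simp [hcol, h0, monskyColor]
  have c1 : col (T.corner 1) = 1 := by simp [hcol, h1, monskyColor]
  have c2 : col (T.corner 2) = 1 := by simp [hcol, h2, monskyColor]
  have c3 : col (T.corner 3) = 2 := by simp [hcol, h3, monskyColor]
  set φ : V → V → ℤ := fun u w =>
    if col u = 0 ∧ col w = 1 then 1 else if col u = 1 ∧ col w = 0 then -1 else 0 with hφ
  have hsum := T.sum_alternating_eq_sum_corner φ (by
    intro u w
    simp only [hφ]
    generalize col u = a
    generalize col w = b
    revert a b
    decide)
  have hne : ∑ i, ∑ k, φ (T.vertex i k) (T.vertex i (k + 1)) ≠ 0 := by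
    rw [hsum]
    simp [Fin.sum_univ_four, hφ, c0, c1, c2, c3]
  obtain ⟨i, -, hi⟩ := Finset.exists_ne_zero_of_sum_ne_zero hne
  refine ⟨i, ?_⟩
  rw [Fin.sum_univ_three] at hi
  rcases color_rainbow _ _ _ hi with h | h | h | h | h | h <;> obtain ⟨ha, hb, hc⟩ := h <;>
    have key := one_le_crossDet_of_monskyColor v ha hb hc
  · exact key
  · rwa [crossDet_rotate] at key
  · rwa [← crossDet_rotate] at key
  · rwa [crossDet_swap, Valuation.map_neg] at key
  · rwa [crossDet_swap, Valuation.map_neg, crossDet_rotate] at key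
  · rwa [crossDet_swap, Valuation.map_neg, ← crossDet_rotate] at key

/-- In any drawing of a disk with parallelogram boundary over a valued field, some triangle is at
least as large as the triangle spanned by three corners. -/
theorem DiskTriangulation.exists_corner_crossDet_le (T : DiskTriangulation V ι) (P : V → K × K)
    (hpar : P (T.corner 0) + P (T.corner 2) = P (T.corner 1) + P (T.corner 3))
    (hD : crossDet (P (T.corner 0)) (P (T.corner 1)) (P (T.corner 3)) ≠ 0) :
    ∃ i, v (crossDet (P (T.corner 0)) (P (T.corner 1)) (P (T.corner 3))) ≤
      v (crossDet (P (T.vertex i 0)) (P (T.vertex i 1)) (P (T.vertex i 2))) := by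
  set D := crossDet (P (T.corner 0)) (P (T.corner 1)) (P (T.corner 3)) with hDdef
  set p := P (T.corner 0)
  set q := P (T.corner 1)
  set r := P (T.corner 2)
  set s := P (T.corner 3)
  have hr1 : r.1 = q.1 + s.1 - p.1 := by
    have := congrArg Prod.fst hpar
    simp only [Prod.fst_add] at this
    linear_combination this
  have hr2 : r.2 = q.2 + s.2 - p.2 := by
    have := congrArg Prod.snd hpar
    simp only [Prod.snd_add] at this
    linear_combination this
  -- Cramer's rule: the affine coordinates in which `p, q, r, s` become the unit square.
  set N : K × K → K × K := fun x => (crossDet p x s / D, crossDet p q x / D) with hN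
  have hDe : D = (q.1 - p.1) * (s.2 - p.2) - (s.1 - p.1) * (q.2 - p.2) := hDdef
  obtain ⟨i, hi⟩ := T.exists_one_le_crossDet v (fun w => N (P w))
    (by simp [hN, p, crossDet])
    (by
      change N q = _
      simp only [hN, Prod.mk.injEq]
      exact ⟨div_self hD, by simp [crossDet]⟩)
    (by
      change N r = _
      simp only [hN, Prod.mk.injEq, div_eq_one_iff_eq hD]
      constructor <;> rw [hDe, crossDet, hr1, hr2] <;> ring)
    (by
      change N s = _
      simp only [hN, Prod.mk.injEq]
      exact ⟨by simp [crossDet], div_self hD⟩)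
  refine ⟨i, ?_⟩
  have key (a b c : K × K) : crossDet (N a) (N b) (N c) = crossDet a b c / D := by
    -- The numerators of `N` form an affine map with determinant `D`; dividing both coordinates by
    -- `D` turns this factor into `D⁻¹`.
    have h : crossDet (crossDet p a s, crossDet p q a) (crossDet p b s, crossDet p q b)
        (crossDet p c s, crossDet p q c) = crossDet a b c * D := by
      rw [hDe]
      simp only [crossDet]
      ring
    simp only [hN]
    rw [crossDet_div (_, _) (_, _) (_, _), h, mul_div_mul_right _ _ hD]
  rw [key, map_div₀, one_le_div₀ (zero_lt_iff.2 ((Valuation.ne_zero_iff v).2 hD))] at hi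
  exact hi

end Coloring

/-! ### Total area -/

/-- The total area of the triangles is the area of the parallelogram. -/
theorem DiskTriangulation.sum_crossDet {K V ι : Type*} [CommRing K] [Fintype V] [DecidableEq V]
    [Fintype ι] (T : DiskTriangulation V ι) (P : V → K × K)
    (hpar : P (T.corner 0) + P (T.corner 2) = P (T.corner 1) + P (T.corner 3)) :
    ∑ i, crossDet (P (T.vertex i 0)) (P (T.vertex i 1)) (P (T.vertex i 2)) =
      2 * crossDet (P (T.corner 0)) (P (T.corner 1)) (P (T.corner 3)) := by
  have h := T.sum_alternating_eq_sum_corner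
    (fun u w => (P u).1 * (P w).2 - (P w).1 * (P u).2) (by intros; ring)
  have e (i : ι) : crossDet (P (T.vertex i 0)) (P (T.vertex i 1)) (P (T.vertex i 2)) =
      ∑ k, ((P (T.vertex i k)).1 * (P (T.vertex i (k + 1))).2 -
        (P (T.vertex i (k + 1))).1 * (P (T.vertex i k)).2) := by
    rw [Fin.sum_univ_three]
    simp only [crossDet, zero_add, Fin.reduceAdd]
    ring
  rw [Finset.sum_congr rfl fun i _ => e i, h, Fin.sum_univ_four]
  simp only [zero_add, Fin.reduceAdd]
  have hr1 : (P (T.corner 2)).1 = (P (T.corner 1)).1 + (P (T.corner 3)).1 - (P (T.corner 0)).1 := by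
    have := congrArg Prod.fst hpar
    simp only [Prod.fst_add] at this
    linear_combination this
  have hr2 : (P (T.corner 2)).2 = (P (T.corner 1)).2 + (P (T.corner 3)).2 - (P (T.corner 0)).2 := by
    have := congrArg Prod.snd hpar
    simp only [Prod.snd_add] at this
    linear_combination this
  rw [hr1, hr2, crossDet]
  ring

/-! ### Homogeneous polynomials and projective hypersurfaces -/

theorem MvPolynomial.IsHomogeneous.aeval_smul {σ R A : Type*} [CommSemiring R] [CommSemiring A]
    [Algebra R A] {f : MvPolynomial σ R} {k : ℕ} (hf : f.IsHomogeneous k) (t : A) (x : σ → A) :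
    MvPolynomial.aeval (t • x) f = t ^ k * MvPolynomial.aeval x f := by
  simp only [MvPolynomial.aeval_def, MvPolynomial.eval₂_eq, Finset.mul_sum]
  refine Finset.sum_congr rfl fun m hm => ?_
  have hk : k = ∑ i ∈ m.support, m i := hf.degree_eq_sum_deg_support hm
  rw [hk, ← Finset.prod_pow_eq_pow_sum]
  simp only [Pi.smul_apply, smul_eq_mul, mul_pow, Finset.prod_mul_distrib]
  ring

theorem MvPolynomial.IsHomogeneous.eval_zero {σ R : Type*} [CommSemiring R]
    {f : MvPolynomial σ R} {k : ℕ} (hf : f.IsHomogeneous k) (hk : k ≠ 0) :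
    MvPolynomial.eval 0 f = 0 := by
  have := hf.aeval_smul (0 : R) 0
  rwa [zero_smul, zero_pow hk, zero_mul] at this

theorem mk_mem_projZeros {σ : Type*} {f : MvPolynomial σ ℂ} {k : ℕ} (hf : f.IsHomogeneous k)
    {x : σ → ℂ} (hx : x ≠ 0) :
    Projectivization.mk ℂ x hx ∈ projZeros f ↔ MvPolynomial.eval x f = 0 := by
  obtain ⟨a, ha⟩ := Projectivization.exists_smul_eq_mk_rep ℂ x hx
  have h : MvPolynomial.eval ((a : ℂ) • x) f = a ^ k * MvPolynomial.eval x f :=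
    hf.aeval_smul (a : ℂ) x
  change MvPolynomial.eval _ f = 0 ↔ _
  rw [← ha, Units.smul_def, h, mul_eq_zero, or_iff_right (pow_ne_zero _ a.ne_zero)]

/-- The projective Nullstellensatz for hypersurfaces. -/
theorem exists_dvd_pow_of_projZeros_subset {σ : Type*} [Finite σ] {F P : MvPolynomial σ ℂ}
    {k m : ℕ} (hF : F.IsHomogeneous k) (hP : P.IsHomogeneous m) (hm : m ≠ 0)
    (h : projZeros F ⊆ projZeros P) : ∃ n, F ∣ P ^ n := by
  have : P ∈ (Ideal.span {F}).radical := by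
    rw [← MvPolynomial.vanishingIdeal_zeroLocus_eq_radical (K := ℂ),
      MvPolynomial.mem_vanishingIdeal_iff]
    intro x hx
    have hx' : MvPolynomial.eval x F = 0 := hx F (Ideal.mem_span_singleton_self F)
    change MvPolynomial.eval x P = 0
    by_cases h0 : x = 0
    · rw [h0]
      exact hP.eval_zero hm
    · exact (mk_mem_projZeros hP h0).1 (h ((mk_mem_projZeros hF h0).2 hx'))
  obtain ⟨n, hn⟩ := this
  exact ⟨n, Ideal.mem_span_singleton.1 hn⟩

theorem projZeros_subset_of_mem_radical {σ : Type*} {F P : MvPolynomial σ ℂ}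
    (h : P ∈ (Ideal.span {F}).radical) : projZeros F ⊆ projZeros P := by
  intro y hy
  obtain ⟨n, hn⟩ := h
  obtain ⟨g, hg⟩ := Ideal.mem_span_singleton.1 hn
  have : MvPolynomial.eval y.rep P ^ n = 0 := by
    rw [← map_pow, hg, map_mul, show MvPolynomial.eval y.rep F = 0 from hy, zero_mul]
  exact eq_zero_of_pow_eq_zero this

attribute [local instance] MvPolynomial.gradedAlgebra in
theorem homogeneousComponent_mem_radical {σ : Type*} {F P : MvPolynomial σ ℂ} {k : ℕ}
    (hF : F.IsHomogeneous k) (h : P ∈ (Ideal.span {F}).radical) (n : ℕ) :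
    MvPolynomial.homogeneousComponent n P ∈ (Ideal.span {F}).radical := by
  refine MvPolynomial.homogeneousComponent_mem_of_mem (Ideal.IsHomogeneous.radical ?_) h n
  refine Ideal.homogeneous_span _ _ ?_
  rintro _ rfl
  exact ⟨k, hF⟩

theorem homogeneousComponent_totalDegree_ne_zero {σ R : Type*} [CommSemiring R]
    {g : MvPolynomial σ R} (hg : g ≠ 0) :
    MvPolynomial.homogeneousComponent g.totalDegree g ≠ 0 := by
  intro h
  obtain ⟨m, hm, hdeg⟩ := Finset.exists_mem_eq_sup g.support
    (MvPolynomial.support_nonempty.2 hg) fun m => m.sum fun _ e => e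
  have h1 := congrArg (MvPolynomial.coeff m) h
  rw [MvPolynomial.coeff_homogeneousComponent, if_pos, MvPolynomial.coeff_zero] at h1
  · exact MvPolynomial.mem_support_iff.1 hm h1
  · rw [MvPolynomial.totalDegree, hdeg]
    rfl

/-- A homogeneous polynomial of least degree among those vanishing on a hypersurface divides all
homogeneous polynomials vanishing there. -/
theorem dvd_of_least_degree {σ : Type*} [Finite σ] {F p f : MvPolynomial σ ℂ} {k m : ℕ}
    (hF0 : F ≠ 0) (hF : F.IsHomogeneous k) (hp0 : p ≠ 0)
    (hp : p.IsHomogeneous p.totalDegree) (hFp : projZeros F ⊆ projZeros p)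
    (hmin : ∀ (G : MvPolynomial σ ℂ) (l : ℕ), G ≠ 0 → G.IsHomogeneous l →
      projZeros F ⊆ projZeros G → p.totalDegree ≤ l)
    (hf : f.IsHomogeneous m) (hm : m ≠ 0) (hFf : projZeros F ⊆ projZeros f) : p ∣ f := by
  classical
  by_cases hd : p.totalDegree = 0
  · rw [MvPolynomial.totalDegree_eq_zero_iff_eq_C] at hd
    refine IsUnit.dvd ?_
    rw [hd] at hp0 ⊢
    exact (isUnit_iff_ne_zero.2 fun h => hp0 (by rw [h, map_zero])).map MvPolynomial.C
  let := UniqueFactorizationMonoid.strongNormalizationMonoid (α := MvPolynomial σ ℂ)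
  -- The squarefree part of `F` divides both `p` and `f`; minimality will make `p` an associate of
  -- it.
  set g := UniqueFactorizationMonoid.radical F with hg
  have hgp : g ∣ p := (UniqueFactorizationMonoid.exists_dvd_pow_iff_radical_dvd hF0).1
    (exists_dvd_pow_of_projZeros_subset hF hp hd hFp)
  have hgf : g ∣ f := (UniqueFactorizationMonoid.exists_dvd_pow_iff_radical_dvd hF0).1
    (exists_dvd_pow_of_projZeros_subset hF hf hm hFf)
  have hg0 : g ≠ 0 := UniqueFactorizationMonoid.radical_ne_zero
  have hgr : g ∈ (Ideal.span {F}).radical := by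
    obtain ⟨n, hn⟩ := UniqueFactorizationMonoid.exists_dvd_radical_self_pow hF0
    exact ⟨n, Ideal.mem_span_singleton.2 hn⟩
  -- Homogeneity of `g` itself is not needed: its top component lies in the homogeneous ideal `√(F)`
  -- and competes with `p` instead.
  have hle : p.totalDegree ≤ g.totalDegree := hmin _ _ (homogeneousComponent_totalDegree_ne_zero hg0)
    (MvPolynomial.homogeneousComponent_isHomogeneous _ _)
    (projZeros_subset_of_mem_radical (homogeneousComponent_mem_radical hF hgr _))
  obtain ⟨u, hu⟩ := hgp
  have hu0 : u ≠ 0 := by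
    rintro rfl
    exact hp0 (by rw [hu, mul_zero])
  have hud : u.totalDegree = 0 := by
    have := MvPolynomial.totalDegree_mul_of_isDomain hg0 hu0
    rw [← hu] at this
    omega
  rw [MvPolynomial.totalDegree_eq_zero_iff_eq_C] at hud
  have huu : IsUnit u := by
    rw [hud] at hu0 ⊢
    exact (isUnit_iff_ne_zero.2 fun h => hu0 (by rw [h, map_zero])).map MvPolynomial.C
  rw [hu]
  exact (huu.mul_right_dvd).2 hgf

/-! ### Descent of divisibility from `ℂ` to `ℤ` -/

/-- Divisibility over `ℂ` of integral polynomials descends to `ℤ` up to an integer factor. -/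
theorem exists_intCast_mul_eq_of_map_dvd {σ : Type*} {p f : MvPolynomial σ ℤ}
    (h : MvPolynomial.map (Int.castRingHom ℂ) p ∣ MvPolynomial.map (Int.castRingHom ℂ) f) :
    ∃ (N : ℕ) (g : MvPolynomial σ ℤ), N ≠ 0 ∧ MvPolynomial.C (N : ℤ) * f = p * g := by
  obtain ⟨h, hh⟩ := h
  -- A `ℚ`-linear retraction of `ℂ` onto `ℚ`, applied to the coefficients of the quotient, makes it
  -- rational, since the other two polynomials have integer coefficients.
  obtain ⟨π, hπ⟩ := (Algebra.linearMap ℚ ℂ).exists_leftInverse_of_injective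
    (LinearMap.ker_eq_bot.2 (algebraMap ℚ ℂ).injective)
  have hπ1 (z : ℤ) : π (z : ℂ) = z := by
    have := LinearMap.congr_fun hπ (z : ℚ)
    simpa using this
  set hq : MvPolynomial σ ℚ := ∑ m ∈ h.support, MvPolynomial.monomial m (π (h.coeff m)) with hhq
  have hq_coeff (m) : hq.coeff m = π (h.coeff m) := by
    classical
    rw [hhq, MvPolynomial.coeff_sum]
    simp only [MvPolynomial.coeff_monomial, Finset.sum_ite_eq', MvPolynomial.mem_support_iff]
    split_ifs with h1
    · rfl
    · rw [not_not.1 h1, map_zero]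
  have hQ : MvPolynomial.map (Int.castRingHom ℚ) f = MvPolynomial.map (Int.castRingHom ℚ) p * hq := by
    classical
    ext m
    have := congrArg (fun q => π (MvPolynomial.coeff m q)) hh
    simp only [MvPolynomial.coeff_map, MvPolynomial.coeff_mul, map_sum, eq_intCast, hπ1] at this
    simp only [MvPolynomial.coeff_map, MvPolynomial.coeff_mul, eq_intCast, hq_coeff]
    rw [this]
    refine Finset.sum_congr rfl fun x _ => ?_
    have e : ((p.coeff x.1 : ℤ) : ℂ) * h.coeff x.2 = ((p.coeff x.1 : ℤ) : ℚ) • h.coeff x.2 := by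
      rw [Algebra.smul_def]; simp
    rw [e, map_smul, smul_eq_mul]
  set N : ℕ := ∏ m ∈ hq.support, (hq.coeff m).den with hN
  have hden (m) : ∃ z : ℤ, (z : ℚ) = N * hq.coeff m := by
    by_cases hm : m ∈ hq.support
    · obtain ⟨c, hc⟩ := Finset.dvd_prod_of_mem (fun m => (hq.coeff m).den) hm
      refine ⟨c * (hq.coeff m).num, ?_⟩
      rw [hN, hc]
      push_cast
      rw [mul_comm ((hq.coeff m).den : ℚ), mul_assoc, Rat.den_mul_eq_num]
    · exact ⟨0, by rw [MvPolynomial.notMem_support_iff.1 hm]; simp⟩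
  choose z hz using hden
  refine ⟨N, ∑ m ∈ hq.support, MvPolynomial.monomial m (z m),
    Finset.prod_ne_zero_iff.2 fun m _ => (hq.coeff m).den_nz, ?_⟩
  apply MvPolynomial.map_injective (Int.castRingHom ℚ) Int.cast_injective
  rw [map_mul, map_mul, hQ, MvPolynomial.map_C, mul_left_comm]
  congr 1
  rw [map_sum]
  nth_rw 1 [hq.as_sum]
  rw [Finset.mul_sum]
  refine Finset.sum_congr rfl fun m _ => ?_
  rw [MvPolynomial.map_monomial, MvPolynomial.C_mul_monomial]
  congr 1
  simp [hz]

/-- For `p` not divisible by `2`, the integer factor can be chosen odd. -/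
theorem exists_odd_mul_eq_of_map_dvd {σ : Type*} {p f : MvPolynomial σ ℤ}
    (hp : ∃ m, ¬ (2 : ℤ) ∣ p.coeff m)
    (h : MvPolynomial.map (Int.castRingHom ℂ) p ∣ MvPolynomial.map (Int.castRingHom ℂ) f) :
    ∃ (N : ℕ) (g : MvPolynomial σ ℤ), Odd N ∧ MvPolynomial.C (N : ℤ) * f = p * g := by
  obtain ⟨N, g, hN, hg⟩ := exists_intCast_mul_eq_of_map_dvd h
  induction N using Nat.strong_induction_on generalizing g with
  | _ N ih =>
    rcases Nat.even_or_odd' N with ⟨M, rfl | hM⟩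
    · have h2 : Prime (MvPolynomial.C 2 : MvPolynomial σ ℤ) :=
        (MvPolynomial.prime_C_iff σ).2 Int.prime_two
      have hC : (MvPolynomial.C ((2 * M : ℕ) : ℤ) : MvPolynomial σ ℤ) =
          MvPolynomial.C 2 * MvPolynomial.C (M : ℤ) := by
        rw [← map_mul]; push_cast; rfl
      rw [hC, mul_assoc] at hg
      have hdvd : MvPolynomial.C 2 ∣ p * g := ⟨_, hg.symm⟩
      rcases h2.dvd_or_dvd hdvd with h | ⟨g', rfl⟩
      · obtain ⟨m, hm⟩ := hp
        exact absurd ((MvPolynomial.C_dvd_iff_dvd_coeff _ _).1 h m) hm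
      · rw [mul_left_comm p] at hg
        exact ih M (by omega) g' (by omega) (mul_left_cancel₀ h2.ne_zero hg)
    · exact ⟨N, g, ⟨M, hM⟩, hg⟩

theorem MvPolynomial.IsHomogeneous.eval_single {σ R : Type*} [DecidableEq σ] [CommSemiring R]
    {p : MvPolynomial σ R} {d : ℕ} (hp : p.IsHomogeneous d) (i : σ) :
    MvPolynomial.eval (Pi.single i 1) p = p.coeff (Finsupp.single i d) := by
  rw [MvPolynomial.eval_eq, Finset.sum_eq_single (Finsupp.single i d)]
  · rw [Finset.prod_eq_one, mul_one]
    intro j hj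
    have := Finsupp.support_single_subset hj
    rw [Finset.mem_singleton.1 this]
    simp
  · intro m hm hne
    by_contra h
    have hz : ∀ j ∈ m.support, j = i := by
      intro j hj
      by_contra hji
      refine h ?_
      rw [Finset.prod_eq_zero hj, mul_zero]
      rw [Pi.single_eq_of_ne hji, zero_pow (Finsupp.mem_support_iff.1 hj)]
    have hmi : m = Finsupp.single i (m i) :=
      Finsupp.support_subset_singleton.1 fun j hj => Finset.mem_singleton.2 (hz j hj)
    refine hne ?_
    have hdeg := hp (MvPolynomial.mem_support_iff.1 hm)
    rw [hmi, Finsupp.weight_single] at hdeg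
    rw [hmi, ← hdeg]
    simp
  · intro h
    rw [MvPolynomial.notMem_support_iff.1 h, zero_mul]

/-! ### Valuations from the absence of relations -/

/-- If no homogeneous relation `(∑ aᵢ) ^ m + 2 c(a) = 0` holds, then some valuation with `v 2 < 1`
is maximal at `∑ aᵢ`. -/
theorem exists_valuationSubring_le_sum {K L : Type*} [Field K] [Fintype L] (a : L → K)
    (h : ∀ (m : ℕ) (c : MvPolynomial L ℤ), c.IsHomogeneous m →
      (∑ i, a i) ^ m + 2 * MvPolynomial.aeval a c ≠ 0) :
    ∃ O : ValuationSubring K, O.valuation 2 < 1 ∧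
      ∀ i, O.valuation (a i) ≤ O.valuation (∑ i, a i) := by
  set s := ∑ i, a i with hs
  have hs0 : s ≠ 0 := by simpa using h 1 0 (MvPolynomial.isHomogeneous_zero _ _ _)
  set b : L → K := s⁻¹ • a with hb
  have hab : a = s • b := by rw [hb, smul_inv_smul₀ hs0]
  set ψ : MvPolynomial L ℤ →+* K := (MvPolynomial.aeval b).toRingHom with hψ
  -- In the ring `ℤ[b]` of normalized areas `2` is not a unit, since homogenizing `1 = 2 f(b)` gives
  -- a forbidden relation. Hence some valuation ring contains `ℤ[b]` and has `2` as a nonunit.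
  have hI : (Ideal.span {(2 : ψ.range)}) ≠ ⊤ := by
    rw [Ne, Ideal.eq_top_iff_one, Ideal.mem_span_singleton]
    rintro ⟨⟨_, f, rfl⟩, hy⟩
    have hy' : (1 : K) = 2 * MvPolynomial.aeval b f := congrArg Subtype.val hy
    set m := f.totalDegree
    set S : MvPolynomial L ℤ := ∑ i, MvPolynomial.X i with hS
    have hSh : S.IsHomogeneous 1 :=
      MvPolynomial.IsHomogeneous.sum _ _ _ fun i _ => MvPolynomial.isHomogeneous_X _ _
    have hSa : MvPolynomial.aeval a S = s := by simp [hS, hs]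
    -- Homogenization of `f` with `S`, which takes the value `s` at `a`, as the extra variable.
    set c := ∑ j ∈ Finset.range (m + 1), MvPolynomial.homogeneousComponent j f * S ^ (m - j)
    have hc : c.IsHomogeneous m := by
      refine MvPolynomial.IsHomogeneous.sum _ _ _ fun j hj => ?_
      have := (MvPolynomial.homogeneousComponent_isHomogeneous j f).mul (hSh.pow (m - j))
      rwa [one_mul, Nat.add_sub_cancel' (Finset.mem_range_succ_iff.1 hj)] at this
    have hca : MvPolynomial.aeval a c = s ^ m * MvPolynomial.aeval b f := by
      conv_rhs => rw [← MvPolynomial.sum_homogeneousComponent f]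
      rw [map_sum, map_sum, Finset.mul_sum]
      refine Finset.sum_congr rfl fun j hj => ?_
      rw [map_mul, map_pow, hSa]
      conv_lhs => rw [hab]
      rw [(MvPolynomial.homogeneousComponent_isHomogeneous j f).aeval_smul, mul_right_comm,
        ← pow_add, Nat.add_sub_cancel' (Finset.mem_range_succ_iff.1 hj)]
    refine h m (-c) hc.neg ?_
    rw [map_neg, hca]
    linear_combination s ^ m * hy'
  obtain ⟨O, hO, hO2⟩ := Ideal.image_subset_nonunits_valuationSubring _ hI
  refine ⟨O, O.mem_nonunits_iff.1 (hO2 ⟨2, Ideal.mem_span_singleton_self _, rfl⟩), fun i => ?_⟩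
  have hbi : b i ∈ O := hO ⟨MvPolynomial.X i, by simp [hψ]⟩
  have : a i = s * b i := congrFun hab i
  rw [this, map_mul]
  exact mul_le_of_le_one_right' ((O.valuation_le_one_iff _).2 hbi)

/-- If no homogeneous relation `(∑ aᵢ) ^ m + 2 c(a) = 0` holds in a ring, then none holds in a
suitable field over it. -/
theorem exists_ringHom_field_ne_zero.{u} {R : Type u} {L : Type*} [CommRing R] [Fintype L] (a : L → R)
    (h : ∀ (m : ℕ) (c : MvPolynomial L ℤ), c.IsHomogeneous m →
      (∑ i, a i) ^ m + 2 * MvPolynomial.aeval a c ≠ 0) :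
    ∃ (K : Type u) (_ : Field K) (g : R →+* K), ∀ (m : ℕ) (c : MvPolynomial L ℤ),
      c.IsHomogeneous m → g ((∑ i, a i) ^ m + 2 * MvPolynomial.aeval a c) ≠ 0 := by
  -- The forbidden values are closed under multiplication and omit `0`, so some prime avoids them
  -- all; its residue field is the field sought.
  let M : Submonoid R :=
    { carrier := {r | ∃ (m : ℕ) (c : MvPolynomial L ℤ), c.IsHomogeneous m ∧
        (∑ i, a i) ^ m + 2 * MvPolynomial.aeval a c = r}
      one_mem' := ⟨0, 0, MvPolynomial.isHomogeneous_zero _ _ _, by simp⟩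
      mul_mem' := by
        rintro _ _ ⟨m, c, hc, rfl⟩ ⟨n, c', hc', rfl⟩
        let S : MvPolynomial L ℤ := ∑ i, MvPolynomial.X i
        have hS : S.IsHomogeneous 1 :=
          MvPolynomial.IsHomogeneous.sum _ _ _ fun i _ => MvPolynomial.isHomogeneous_X _ _
        have hSm (k : ℕ) : (S ^ k).IsHomogeneous k := by simpa using hS.pow k
        refine ⟨m + n, S ^ m * c' + c * S ^ n + MvPolynomial.C 2 * (c * c'),
          (((hSm m).mul hc').add (hc.mul (hSm n))).add ((hc.mul hc').C_mul 2), ?_⟩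
        simp only [S, map_add, map_mul, map_pow, map_sum, MvPolynomial.aeval_X,
          map_ofNat]
        ring }
  obtain ⟨q, hq, -, hdisj⟩ := Ideal.exists_le_prime_disjoint (⊥ : Ideal R) M (by
    rw [Set.disjoint_left]
    rintro x hx ⟨m, c, hc, hmc⟩
    exact h m c hc (hmc.trans hx))
  refine ⟨FractionRing (R ⧸ q), inferInstance,
    (algebraMap (R ⧸ q) (FractionRing (R ⧸ q))).comp (Ideal.Quotient.mk q), ?_⟩
  intro m c hc h0
  have h1 := (map_eq_zero_iff _ (IsFractionRing.injective (R ⧸ q) (FractionRing (R ⧸ q)))).1 h0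
  exact Set.disjoint_left.1 hdisj (Ideal.Quotient.eq_zero_iff_mem.1 h1) ⟨m, c, hc, rfl⟩

/-! ### The area relation for drawings -/

theorem map_crossDet {R K : Type*} [CommRing R] [CommRing K] (g : R →+* K) (a b c : R × R) :
    crossDet (Prod.map g g a) (Prod.map g g b) (Prod.map g g c) = g (crossDet a b c) := by
  simp [crossDet]

theorem two_mul_triangleArea (a b c : ℂ × ℂ) : 2 * triangleArea a b c = crossDet a b c := by
  simp only [triangleArea, crossDet, Matrix.det_fin_three, Matrix.of_apply, Matrix.cons_val]
  ring

theorem crossDet_eq_zero_of_collinear {K : Type*} [Field K] {s : Set (K × K)}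
    (hs : Collinear K s) {a b c : K × K} (ha : a ∈ s) (hb : b ∈ s) (hc : c ∈ s) :
    crossDet a b c = 0 := by
  obtain ⟨p, w, h⟩ := (collinear_iff_exists_forall_eq_smul_vadd s).1 hs
  obtain ⟨x, rfl⟩ := h a ha
  obtain ⟨y, rfl⟩ := h b hb
  obtain ⟨z, rfl⟩ := h c hc
  simp only [crossDet, vadd_eq_add, Prod.fst_add, Prod.snd_add, Prod.smul_fst, Prod.smul_snd,
    smul_eq_mul]
  ring

namespace ConstrainedTriangulation

variable {V ι : Type*} [Fintype V] [DecidableEq V] [Fintype ι]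

theorem crossDet_eq_zero_of_not_alive (T : ConstrainedTriangulation V ι) {ρ : V → ℂ × ℂ}
    (hρ : T.IsDrawing ρ) {i : ι} (hi : ¬ T.Alive i) :
    crossDet (ρ (T.vertex i 0)) (ρ (T.vertex i 1)) (ρ (T.vertex i 2)) = 0 := by
  simp only [Alive, not_forall, not_not] at hi
  obtain ⟨C, hC, hsub⟩ := hi
  have hmem (k : Fin 3) : ρ (T.vertex i k) ∈ ρ '' (C : Set V) :=
    ⟨_, hsub (Finset.mem_image_of_mem _ (Finset.mem_univ k)), rfl⟩
  exact crossDet_eq_zero_of_collinear (hρ.1 C hC) (hmem 0) (hmem 1) (hmem 2)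

/-- Monsky's theorem as an integrality relation, for coordinates in a commutative ring: half the
total area is integral over the areas of the living triangles. -/
theorem exists_pow_add_two_mul_eq_zero_of_ring (T : ConstrainedTriangulation V ι)
    [Fintype T.Living] {R : Type*} [CommRing R] (h2 : IsUnit (2 : R)) (x : V → R × R)
    (a : T.Living → R)
    (hpar : x (T.corner 0) + x (T.corner 2) = x (T.corner 1) + x (T.corner 3))
    (hdead : ∀ i, ¬ T.Alive i →
      crossDet (x (T.vertex i 0)) (x (T.vertex i 1)) (x (T.vertex i 2)) = 0)
    (halive : ∀ i : T.Living,
      crossDet (x (T.vertex i 0)) (x (T.vertex i 1)) (x (T.vertex i 2)) = 2 * a i) :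
    ∃ (m : ℕ) (c : MvPolynomial T.Living ℤ), c.IsHomogeneous m ∧
      (∑ i, a i) ^ m + 2 * MvPolynomial.aeval a c = 0 := by
  classical
  by_contra! hcon
  obtain ⟨K, _, g, hg⟩ := exists_ringHom_field_ne_zero a hcon
  -- Needed to cancel the `2` in `sum_crossDet`, so that the corner determinant equals the sum of
  -- the living areas.
  have h2K : (2 : K) ≠ 0 := by
    have := (h2.map g).ne_zero
    rwa [map_ofNat] at this
  obtain ⟨O, hO2, hO⟩ := exists_valuationSubring_le_sum (fun i => g (a i)) (by
    intro m c hc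
    have := hg m c hc
    rwa [map_add, map_pow, map_sum, map_mul, map_ofNat,
      show g (MvPolynomial.aeval a c) = MvPolynomial.aeval (fun i => g (a i)) c from
        MvPolynomial.comp_aeval_apply (f := a) g.toIntAlgHom c] at this)
  have hpar' : Prod.map g g (x (T.corner 0)) + Prod.map g g (x (T.corner 2)) =
      Prod.map g g (x (T.corner 1)) + Prod.map g g (x (T.corner 3)) := by
    have := congrArg (RingHom.prodMap g g) hpar
    rw [map_add, map_add] at this
    exact this
  have hD : crossDet (Prod.map g g (x (T.corner 0))) (Prod.map g g (x (T.corner 1)))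
      (Prod.map g g (x (T.corner 3))) = ∑ i, g (a i) := by
    have h := T.sum_crossDet (fun w => Prod.map g g (x w)) hpar'
    refine mul_left_cancel₀ h2K ?_
    rw [← h, Finset.mul_sum, ← Finset.sum_filter_add_sum_filter_not Finset.univ T.Alive,
      Finset.sum_eq_zero (s := Finset.univ.filter fun i => ¬ T.Alive i), add_zero,
      Finset.sum_subtype (F := ‹Fintype T.Living›) (p := T.Alive) _ (by simp)]
    · refine Finset.sum_congr rfl fun i _ => ?_
      rw [map_crossDet, halive, map_mul, map_ofNat]
    · intro i hi
      rw [map_crossDet, hdead i (Finset.mem_filter.1 hi).2, map_zero]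
  have hs0 : ∑ i, g (a i) ≠ 0 := by
    simpa using hg 1 0 (MvPolynomial.isHomogeneous_zero _ _ _)
  obtain ⟨i, hi⟩ := T.exists_corner_crossDet_le O.valuation (fun w => Prod.map g g (x w)) hpar'
    (by rw [hD]; exact hs0)
  rw [hD, map_crossDet] at hi
  have hpos : 0 < O.valuation (∑ i, g (a i)) := zero_lt_iff.2 ((Valuation.ne_zero_iff _).2 hs0)
  -- The large triangle cannot be living, as `v (2 * a i) < v s`, nor dead, as its determinant would
  -- be `0`.
  by_cases hal : T.Alive i
  · rw [halive ⟨i, hal⟩, map_mul, map_ofNat, map_mul] at hi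
    refine absurd hi (not_le.2 ?_)
    exact (mul_le_mul_right (hO ⟨i, hal⟩) _).trans_lt (mul_lt_of_lt_one_left hpos hO2)
  · rw [hdead i hal, map_zero, map_zero] at hi
    exact absurd hi (not_le.2 hpos)

/-- A single integrality relation for half the total area holds on all drawings. -/
theorem exists_pow_add_two_mul_eq_zero (T : ConstrainedTriangulation V ι) [Fintype T.Living] :
    ∃ (m : ℕ) (c : MvPolynomial T.Living ℤ), c.IsHomogeneous m ∧ ∀ ρ, T.IsDrawing ρ →
      (∑ i, T.areas ρ i) ^ m + 2 * MvPolynomial.aeval (T.areas ρ) c = 0 := by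
  obtain ⟨m, c, hc, h⟩ := T.exists_pow_add_two_mul_eq_zero_of_ring
    -- One relation in this function ring is a relation with the same `m` and `c` for every drawing.
    (R := {ρ // T.IsDrawing ρ} → ℂ)
    (IsUnit.of_mul_eq_one (fun _ => 1 / 2) (funext fun ρ => mul_one_div_cancel two_ne_zero))
    (fun w => (fun ρ => (ρ.1 w).1, fun ρ => (ρ.1 w).2)) (fun i ρ => T.areas ρ.1 i)
    (Prod.ext (funext fun ρ => congrArg Prod.fst ρ.2.2)
      (funext fun ρ => congrArg Prod.snd ρ.2.2))
    (fun i hi => funext fun ρ => T.crossDet_eq_zero_of_not_alive ρ.2 hi)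
    (fun i => funext fun ρ => (two_mul_triangleArea _ _ _).symm)
  refine ⟨m, c, hc, fun ρ hρ => ?_⟩
  let e := Pi.evalRingHom (fun _ : {ρ // T.IsDrawing ρ} => ℂ) ⟨ρ, hρ⟩
  have h1 := congrArg e h
  have h2 := MvPolynomial.comp_aeval_apply (f := fun i (ρ : {ρ // T.IsDrawing ρ}) => T.areas ρ.1 i)
    e.toIntAlgHom c
  rw [map_add, map_pow, map_sum, map_mul, map_ofNat, map_zero] at h1
  change _ = MvPolynomial.aeval (T.areas ρ) c at h2
  rw [← h2]
  exact h1

theorem continuous_areas (T : ConstrainedTriangulation V ι) : Continuous T.areas := by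
  refine continuous_pi fun i => ?_
  simp only [areas, triangleArea, Matrix.det_fin_three, Matrix.of_apply, Matrix.cons_val]
  fun_prop

/-- A homogeneous polynomial relation between the areas of all drawings holds on the area
variety. -/
theorem areaVariety_subset_projZeros (T : ConstrainedTriangulation V ι)
    {f : MvPolynomial T.Living ℂ} {k : ℕ} (hf : f.IsHomogeneous k)
    (h : ∀ ρ, T.IsDrawing ρ → MvPolynomial.eval (T.areas ρ) f = 0) :
    T.areaVariety ⊆ projZeros f := by
  intro y hy
  refine hy f k hf ?_
  rintro _ ⟨ρ, hρ, hne, rfl⟩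
  rw [mk_mem_projZeros hf]
  have hcl : IsClosed {ρ | MvPolynomial.eval (T.areas ρ) f = 0} :=
    isClosed_eq (f.continuous_eval.comp T.continuous_areas) continuous_const
  exact closure_minimal (fun ρ' hρ' => h ρ' hρ'.1) hcl hρ

end ConstrainedTriangulation

/-! ### The parity of the coefficients -/

theorem mainTheorem7 {V ι : Type*} [Fintype V] [DecidableEq V] [Fintype ι]
    (T : ConstrainedTriangulation V ι) (hT : T.Hyper)
    (p : MvPolynomial T.Living ℤ) (hp : T.IsAreaPolynomial p)
    (d : ℕ) (hd : p.totalDegree = d) (i : T.Living) :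
    Odd (p.coeff (Finsupp.single i d)) ∧ p.coeff (Finsupp.single i d) ≠ 0 := by
  classical
  have : Fintype T.Living := Fintype.ofFinite _
  subst hd
  suffices h : Odd (p.coeff (Finsupp.single i p.totalDegree)) from
    ⟨h, fun h0 => by rw [h0] at h; exact absurd h (by decide)⟩
  obtain ⟨hp0, hph, hpV, hpmin, hprim⟩ := hp
  obtain ⟨-, F, k, -, hF0, hF, hV⟩ := hT
  obtain ⟨m, c, hc, hrel⟩ := T.exists_pow_add_two_mul_eq_zero
  set S : MvPolynomial T.Living ℤ := ∑ i, MvPolynomial.X i with hS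
  have hSh : S.IsHomogeneous 1 :=
    MvPolynomial.IsHomogeneous.sum _ _ _ fun i _ => MvPolynomial.isHomogeneous_X _ _
  -- The extra factor `S` makes the degree positive even if `m = 0`, and has value `1` at each basis
  -- vector.
  set f : MvPolynomial T.Living ℤ := S * (S ^ m + MvPolynomial.C 2 * c) with hf
  have hfh : f.IsHomogeneous (1 + m) := by
    refine hSh.mul (MvPolynomial.IsHomogeneous.add ?_ (hc.C_mul 2))
    simpa using hSh.pow m
  have hinj : Function.Injective (Int.castRingHom ℂ) := Int.cast_injective
  have hdeg : (MvPolynomial.map (Int.castRingHom ℂ) p).totalDegree = p.totalDegree :=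
    (hph.map _).totalDegree ((map_ne_zero_iff _ (MvPolynomial.map_injective _ hinj)).2 hp0)
  have hfV : T.areaVariety ⊆ projZeros (MvPolynomial.map (Int.castRingHom ℂ) f) := by
    refine T.areaVariety_subset_projZeros (hfh.map _) fun ρ hρ => ?_
    have h := hrel ρ hρ
    rw [MvPolynomial.eval_map]
    change MvPolynomial.aeval (T.areas ρ) f = 0
    have h2 : MvPolynomial.aeval (T.areas ρ) (S ^ m + MvPolynomial.C 2 * c) = 0 := by
      rw [map_add, map_pow, map_mul, MvPolynomial.aeval_C, hS, map_sum]
      simpa using h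
    rw [hf, map_mul, h2, mul_zero]
  have hdvd : MvPolynomial.map (Int.castRingHom ℂ) p ∣ MvPolynomial.map (Int.castRingHom ℂ) f := by
    refine dvd_of_least_degree hF0 hF ?_ ?_ (hV ▸ hpV) ?_ (hfh.map _) (by omega) (hV ▸ hfV)
    · exact (map_ne_zero_iff _ (MvPolynomial.map_injective _ hinj)).2 hp0
    · rw [hdeg]
      exact hph.map _
    · rw [hdeg]
      exact fun G l hG hGh hGV => hpmin G l hG hGh (hV ▸ hGV)
  have hodd : ∃ n, ¬ (2 : ℤ) ∣ p.coeff n := by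
    by_contra! h
    exact absurd (hprim 2 h) (by decide)
  obtain ⟨N, g, hN, hg⟩ := exists_odd_mul_eq_of_map_dvd hodd hdvd
  have hev := congrArg (MvPolynomial.eval (Pi.single i 1)) hg
  have hSe : MvPolynomial.eval (Pi.single i 1) S = 1 := by
    simp [hS, Finset.sum_pi_single']
  rw [map_mul, map_mul _ p, MvPolynomial.eval_C, hph.eval_single, hf, map_mul, map_add, map_pow,
    hSe, map_mul _ (MvPolynomial.C 2), MvPolynomial.eval_C, one_pow, one_mul] at hev
  have hl : Odd ((N : ℤ) * (1 + 2 * MvPolynomial.eval (Pi.single i 1) c)) :=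
    ((Int.odd_coe_nat N).2 hN).mul (odd_one.add_even (even_two_mul _))
  rw [hev] at hl
  exact (Int.odd_mul.1 hl).1
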